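/- **Proposition 1.4 (Bounds for small and large parameters).** For $n\ge 1$ and $p\in[0,1]$, consider the following game ${\rm ab}_n(p)$. Two players, Alice and Bob, take turns to play $n$ moves each; Alice starts, and at each turn the player has the choice between two moves. The state of the game is the pair $(a,b)\in\mathbb N^2\times\mathbb N^2$, where $a$ (resp. $b$) records how often Alice (resp. Bob) has so far played each of the two moves. The outcome of the game is its final state, so that there are $(n+1)^2$ possible outcomes. Before the game, a winner is assigned to each possible outcome, independently for different outcomes, and for each outcome Bob is the winner with probability $p$ and Alice with probability $1-p$; both players know this assignment. A strategy of a player is a function that prescribes a move in each state in which it is that player's turn, and a strategy of Bob is winning (for a given assignment of winners) if, whichever strategy Alice plays, the resulting outcome is one for which Bob is the winner. Let $P_n^{\rm ab}(p)$ denote the probability that Bob has a winning strategy. Then $$\lim_{n\to\infty}P_n^{\rm ab}(p)=\begin{cases}0&\text{if }0\le p<1/64,\\ 1&\text{if }15/16<p\le 1.\end{cases}$$ -/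

import Mathlib

open MeasureTheory ProbabilityTheory Filter Topology
open Finset.HasAntidiagonal (antidiagonal mem_antidiagonal)
open scoped unitInterval

namespace AbGame

/-- The number of times a player has so far played each of the two possible moves. -/
abbrev Counts : Type := ℕ × ℕ

/-- A state of the game: the counts of Alice and the counts of Bob. -/
abbrev State : Type := Counts × Counts

/-- Play one more move; `false` is the first of the two moves and `true` is the second. -/
def addMove : Counts → Bool → Counts
  | (i, j), false => (i + 1, j)
  | (i, j), true => (i, j + 1)

/-- A (pure) strategy of a player prescribes the move to be played in each state. Only its values
at the reachable states where it is that player's turn ever matter. -/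
abbrev Strategy : Type := State → Bool

/-- One round: first Alice moves following `σ₁`, then Bob moves following `σ₂` in the
new state. -/
def playRound (σ₁ σ₂ : Strategy) (v : State) : State :=
  let w : State := (addMove v.1 (σ₁ v), v.2)
  (w.1, addMove w.2 (σ₂ w))

/-- The state after `n` rounds, started from the state in which nobody has moved yet. -/
def play (σ₁ σ₂ : Strategy) : ℕ → State
  | 0 => ((0, 0), (0, 0))
  | n + 1 => playRound σ₁ σ₂ (play σ₁ σ₂ n)

/-- The possible outcomes of the game with `n` rounds: the states in which both players have played
exactly `n` moves. -/
abbrev Outcome (n : ℕ) : Type := ↥(antidiagonal n) × ↥(antidiagonal n)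

theorem addMove_mem {n : ℕ} {c : Counts} (h : c ∈ antidiagonal n) (m : Bool) :
    addMove c m ∈ antidiagonal (n + 1) := by
  obtain ⟨i, j⟩ := c
  rw [mem_antidiagonal] at h ⊢
  cases m <;> simp only [addMove] at h ⊢ <;> omega

theorem play_mem (σ₁ σ₂ : Strategy) (n : ℕ) :
    (play σ₁ σ₂ n).1 ∈ antidiagonal n ∧ (play σ₁ σ₂ n).2 ∈ antidiagonal n := by
  induction n with
  | zero => simp [play]
  | succ n ih => exact ⟨addMove_mem ih.1 _, addMove_mem ih.2 _⟩

/-- The outcome of the game with `n` rounds if Alice plays `σ₁` and Bob plays `σ₂`. -/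
def outcome (n : ℕ) (σ₁ σ₂ : Strategy) : Outcome n :=
  (⟨(play σ₁ σ₂ n).1, (play_mem σ₁ σ₂ n).1⟩, ⟨(play σ₁ σ₂ n).2, (play_mem σ₁ σ₂ n).2⟩)

/-- Given an assignment `x` of winners to outcomes (`true` if Bob wins, `false` if Alice wins), Bob
has a winning strategy. -/
def BobWins (n : ℕ) (x : Outcome n → Bool) : Prop :=
  ∃ σ₂ : Strategy, ∀ σ₁ : Strategy, x (outcome n σ₁ σ₂) = true

/-- The law of an i.i.d. assignment of winners to outcomes, each outcome being a win for Bob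
(`true`) with probability `p`. -/
noncomputable def winnerLaw (n : ℕ) (p : I) : Measure (Outcome n → Bool) :=
  Measure.pi fun _ => bernoulliMeasure true false p

/-- The probability that Bob has a winning strategy in the game with `n` rounds. -/
noncomputable def bobWinProb (n : ℕ) (p : I) : ℝ :=
  (winnerLaw n p).real {x | BobWins n x}

end AbGame

/-! A Peierls argument on the set of outcomes. Suppose Bob can force a win. For either move of Alice
he has a good reply, so each winning state splits into two winning states, one per move of Alice.
Splitting round by round turns the initial state into a chain of outcomes won by Bob along which
Alice's count of second moves goes from 0 to `n`; the steps obey `ContourStep`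
(`BobForces.hasContour`). If Bob cannot force a win, the players swap roles and the chain consists
of outcomes won by Alice (`hasContour_of_not_bobForces`). Such chains are unlikely when their colour
is rare: weighting a point at height `u` by `2 ^ u` shows that at most `(12 + 8κ) ^ m / 2 ^ n`
contours of `m` steps climb from a given point at height 0 to height `n`. If the colour has
probability at most `1 / (12 + 8κ)`, a union bound over starting points and lengths gives `(n + 1) ^
4 / 2 ^ n`, which tends to 0 (`pi_real_hasContour_le`). -/

namespace AbGame

/-! ### Counting contours and the Peierls bound -/

section Percolation

variable {V : Type*} (u s : V → ℕ)

/-- The steps of the contours: the height `u` increases by at most one, and the change of the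
transversal coordinate `s` is controlled by the decrease of the height. -/
def ContourStep (κ : ℕ) (v w : V) : Prop :=
  u w ≤ u v + 1 ∧ |(s w : ℤ) - s v| + u w ≤ κ + 1 + u v

theorem sum_range_width_mul_two_pow (κ K : ℕ) :
    ∑ k ∈ Finset.range (K + 1), (2 * (κ + (K - k)) + 1) * 2 ^ k + (2 * K + 2 * κ + 5) =
      (6 + 4 * κ) * 2 ^ K := by
  induction K with
  | zero => simp; ring
  | succ K ih =>
    rw [Finset.sum_range_succ', pow_succ, ← mul_assoc, ← ih]
    have : ∀ k ∈ Finset.range (K + 1), (2 * (κ + (K + 1 - (k + 1))) + 1) * 2 ^ (k + 1) =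
        2 * ((2 * (κ + (K - k)) + 1) * 2 ^ k) := by
      intro k _
      rw [Nat.add_sub_add_right, pow_succ]
      ring
    rw [Finset.sum_congr rfl this, ← Finset.mul_sum]
    simp only [Nat.sub_zero, pow_zero]
    ring

variable [Fintype V]

open Classical in
theorem card_filter_height_le (hus : ∀ v w, u v = u w → s v = s w → v = w) (v : V) (ρ k : ℕ) :
    (Finset.univ.filter fun w => u w = k ∧ |(s w : ℤ) - s v| ≤ ρ).card ≤ 2 * ρ + 1 := by
  have h : (Finset.Icc ((s v : ℤ) - ρ) (s v + ρ)).card = 2 * ρ + 1 := by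
    rw [Int.card_Icc]; omega
  rw [← h]
  refine Finset.card_le_card_of_injOn (fun w => (s w : ℤ)) ?_ ?_
  · intro w hw
    simp only [Finset.coe_filter, Finset.mem_univ, true_and, Set.mem_ofPred_eq, abs_le] at hw
    simp only [Finset.coe_Icc, Set.mem_Icc]
    omega
  · intro a ha b hb hab
    simp only [Finset.coe_filter, Finset.mem_univ, true_and, Set.mem_ofPred_eq] at ha hb
    exact hus a b (ha.1.trans hb.1.symm) (Int.ofNat_inj.1 hab)

open Classical in
-- A step to height `k` leaves at most `2(κ + u v + 1 - k) + 1` values of `s`. This grows only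
-- linearly in the drop, while the weight `2 ^ k` decays geometrically.
theorem sum_contourStep_two_pow_le (hus : ∀ v w, u v = u w → s v = s w → v = w) (κ : ℕ) (v : V) :
    ∑ w ∈ Finset.univ.filter (ContourStep u s κ v), 2 ^ u w ≤ (12 + 8 * κ) * 2 ^ u v := by
  have hmap : ∀ w ∈ Finset.univ.filter (ContourStep u s κ v),
      u w ∈ Finset.range (u v + 1 + 1) := by
    intro w hw
    have := (Finset.mem_filter.1 hw).2.1
    rw [Finset.mem_range]; omega
  rw [← Finset.sum_fiberwise_of_maps_to hmap]
  calc _ ≤ ∑ k ∈ Finset.range (u v + 1 + 1), (2 * (κ + (u v + 1 - k)) + 1) * 2 ^ k := by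
        refine Finset.sum_le_sum fun k hk => ?_
        rw [Finset.mem_range] at hk
        rw [Finset.sum_congr rfl (g := fun _ => 2 ^ k)
          (fun w hw => by rw [(Finset.mem_filter.1 hw).2]), Finset.sum_const, smul_eq_mul]
        refine Nat.mul_le_mul_right _ ((Finset.card_le_card ?_).trans
          (card_filter_height_le u s hus v (κ + (u v + 1 - k)) k))
        intro w hw
        simp only [Finset.mem_filter, Finset.mem_univ, true_and, ContourStep] at hw ⊢
        refine ⟨hw.2, ?_⟩
        have := hw.1.2
        push_cast [Nat.lt_succ_iff.1 hk]
        omega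
    _ ≤ (6 + 4 * κ) * 2 ^ (u v + 1) := by
        rw [← sum_range_width_mul_two_pow]; omega
    _ = _ := by ring

open Classical in
/-- The contours of `m` steps that start at a given point and end at height `n`. -/
noncomputable def contours (κ n : ℕ) : ℕ → V → Finset (List V)
  | 0, v => if u v = n then {[v]} else ∅
  | m + 1, v => (Finset.univ.filter (ContourStep u s κ v)).biUnion fun w =>
      (contours κ n m w).image (List.cons v)

theorem card_contours_le (hus : ∀ v w, u v = u w → s v = s w → v = w) (κ n m : ℕ) (v : V) :
    (contours u s κ n m v).card * 2 ^ n ≤ (12 + 8 * κ) ^ m * 2 ^ u v := by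
  classical
  induction m generalizing v with
  | zero =>
    unfold contours
    split_ifs with h <;> simp [h]
  | succ m ih =>
    unfold contours
    calc _ ≤ (∑ w ∈ Finset.univ.filter (ContourStep u s κ v),
            (contours u s κ n m w).card) * 2 ^ n :=
          Nat.mul_le_mul_right _ (Finset.card_biUnion_le.trans
            (Finset.sum_le_sum fun w _ => Finset.card_image_le))
      _ ≤ ∑ w ∈ Finset.univ.filter (ContourStep u s κ v), (12 + 8 * κ) ^ m * 2 ^ u w := by
          rw [Finset.sum_mul]
          exact Finset.sum_le_sum fun w _ => ih w
      _ ≤ (12 + 8 * κ) ^ m * ((12 + 8 * κ) * 2 ^ u v) := by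
          rw [← Finset.mul_sum]
          exact Nat.mul_le_mul_left _ (sum_contourStep_two_pow_le u s hus κ v)
      _ = _ := by ring

variable {u s}

theorem length_of_mem_contours {κ n m : ℕ} {v : V} {l : List V}
    (hl : l ∈ contours u s κ n m v) : l.length = m + 1 := by
  classical
  induction m generalizing v l with
  | zero =>
    unfold contours at hl
    split_ifs at hl <;> simp_all
  | succ m ih =>
    unfold contours at hl
    simp only [Finset.mem_biUnion, Finset.mem_image] at hl
    obtain ⟨w, -, l', hl', rfl⟩ := hl
    simp [ih hl']

theorem exists_suffix_mem_contours {κ n m : ℕ} {v a : V} {l : List V}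
    (hl : l ∈ contours u s κ n m v) (ha : a ∈ l) :
    ∃ m' l', l' ∈ contours u s κ n m' a ∧ l' <:+ l := by
  classical
  induction m generalizing v l with
  | zero =>
    have hl0 := hl
    unfold contours at hl
    split_ifs at hl
    · rw [Finset.mem_singleton] at hl
      subst hl
      rw [List.mem_singleton] at ha
      subst ha
      exact ⟨0, _, hl0, List.suffix_rfl⟩
    · simp at hl
  | succ m ih =>
    have hl0 := hl
    unfold contours at hl
    simp only [Finset.mem_biUnion, Finset.mem_image] at hl
    obtain ⟨w, -, l', hl', rfl⟩ := hl
    rcases List.mem_cons.1 ha with rfl | ha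
    · exact ⟨m + 1, _, hl0, List.suffix_rfl⟩
    · obtain ⟨m', l'', h, h'⟩ := ih hl' ha
      exact ⟨m', l'', h, h'.trans (List.suffix_cons _ _)⟩

/-- Loop erasure. Distinct points are needed so that their colours are independent, and they bound
the length by the number of points. -/
theorem exists_nodup_mem_contours {κ n : ℕ} {Q : V → Prop} {v w : V} (hw : u w = n) (hQ : Q v)
    (h : Relation.ReflTransGen (fun a b => ContourStep u s κ a b ∧ Q b) v w) :
    ∃ m l, l ∈ contours u s κ n m v ∧ l.Nodup ∧ ∀ a ∈ l, Q a := by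
  classical
  induction h using Relation.ReflTransGen.head_induction_on with
  | refl => exact ⟨0, [w], by simp [contours, hw], by simp, by simpa⟩
  | @head a b hab _ ih =>
    obtain ⟨m, l, hl, hn, hlQ⟩ := ih hab.2
    by_cases ha : a ∈ l
    · obtain ⟨m', l', hl', hs⟩ := exists_suffix_mem_contours hl ha
      exact ⟨m', l', hl', hn.sublist hs.sublist, fun c hc => hlQ c (hs.mem hc)⟩
    · refine ⟨m + 1, a :: l, ?_, List.nodup_cons.2 ⟨ha, hn⟩, ?_⟩
      · unfold contours
        simp only [Finset.mem_biUnion, Finset.mem_image, Finset.mem_filter, Finset.mem_univ,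
          true_and]
        exact ⟨b, hab.1, l, hl, rfl⟩
      · simpa using ⟨hQ, hlQ⟩

/-- There is a contour of colour `c` that starts at height zero and ends at height `n`. -/
def HasContour (u s : V → ℕ) (κ n : ℕ) (c : Bool) (x : V → Bool) : Prop :=
  ∃ v w, u v = 0 ∧ u w = n ∧ x v = c ∧
    Relation.ReflTransGen (fun a b => ContourStep u s κ a b ∧ x b = c) v w

theorem pi_real_forall_mem_list (μ : Measure Bool) [IsProbabilityMeasure μ] (c : Bool)
    {l : List V} (hl : l.Nodup) :
    (Measure.pi fun _ : V => μ).real {x | ∀ a ∈ l, x a = c} = μ.real {c} ^ l.length := by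
  classical
  have h : {x : V → Bool | ∀ a ∈ l, x a = c} =
      (l.toFinset : Set V).pi fun _ => ({c} : Set Bool) := by
    ext x; simp [Set.mem_pi]
  rw [h, measureReal_def, Measure.pi_pi_finset, Finset.prod_const, ENNReal.toReal_pow,
    List.toFinset_card_of_nodup hl, measureReal_def]

theorem pi_real_hasContour_le (μ : Measure Bool) [IsProbabilityMeasure μ] (c : Bool)
    (hus : ∀ v w, u v = u w → s v = s w → v = w) (κ n : ℕ)
    (hμ : (12 + 8 * κ) * μ.real {c} ≤ 1) :
    (Measure.pi fun _ : V => μ).real {x | HasContour u s κ n c x} ≤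
      (Fintype.card V : ℝ) ^ 2 / 2 ^ n := by
  classical
  set M := Fintype.card V
  set q := μ.real {c}
  have hq0 : 0 ≤ q := measureReal_nonneg
  have hq1 : q ≤ 1 := measureReal_le_one
  let E : List V → Set (V → Bool) := fun l => {x | ∀ a ∈ l, x a = c}
  let F : V → ℕ → Finset (List V) := fun v m => (contours u s κ n m v).filter List.Nodup
  have hsub : {x | HasContour u s κ n c x} ⊆
      ⋃ v ∈ Finset.univ.filter (fun v => u v = 0), ⋃ m ∈ Finset.range M, ⋃ l ∈ F v m, E l := by
    rintro x ⟨v, w, hv, hw, hx, h⟩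
    obtain ⟨m, l, hl, hn, hlx⟩ := exists_nodup_mem_contours (Q := fun a => x a = c) hw hx h
    simp only [Set.mem_iUnion]
    refine ⟨v, by simpa using hv, m, ?_, l, Finset.mem_filter.2 ⟨hl, hn⟩, hlx⟩
    have := hn.length_le_card
    rw [length_of_mem_contours hl] at this
    exact Finset.mem_range.2 this
  have hbound : ∀ v ∈ Finset.univ.filter (fun v => u v = 0), ∀ m,
      (Measure.pi fun _ : V => μ).real (⋃ l ∈ F v m, E l) ≤ 1 / 2 ^ n := by
    intro v hv m
    have hv0 : u v = 0 := (Finset.mem_filter.1 hv).2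
    have hE : ∀ l ∈ F v m, (Measure.pi fun _ : V => μ).real (E l) ≤ q ^ m := by
      intro l hl
      obtain ⟨hl, hn⟩ := Finset.mem_filter.1 hl
      rw [pi_real_forall_mem_list μ c hn, length_of_mem_contours hl]
      -- A contour of `m` steps has `m + 1` points; one factor `q` is given away.
      exact pow_le_pow_of_le_one hq0 hq1 (Nat.le_succ m)
    have hcard : ((F v m).card : ℝ) * 2 ^ n ≤ (12 + 8 * κ) ^ m := by
      have h1 := card_contours_le u s hus κ n m v
      rw [hv0, pow_zero, mul_one] at h1
      have h2 : (F v m).card * 2 ^ n ≤ (12 + 8 * κ) ^ m :=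
        (Nat.mul_le_mul_right _ (Finset.card_filter_le _ _)).trans h1
      exact_mod_cast h2
    calc _ ≤ ∑ l ∈ F v m, (Measure.pi fun _ : V => μ).real (E l) :=
          measureReal_biUnion_finset_le _ _
      _ ≤ (F v m).card * q ^ m := by
          simpa using Finset.sum_le_sum hE
      _ ≤ 1 / 2 ^ n := by
          rw [le_div_iff₀ (by positivity)]
          calc _ = ((F v m).card * 2 ^ n) * q ^ m := by ring
            _ ≤ (12 + 8 * κ) ^ m * q ^ m := by gcongr
            _ = ((12 + 8 * κ) * q) ^ m := by rw [mul_pow]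
            _ ≤ 1 := pow_le_one₀ (by positivity) hμ
  calc _ ≤ _ := measureReal_mono hsub (measure_ne_top _ _)
    _ ≤ ∑ v ∈ Finset.univ.filter (fun v => u v = 0), ∑ m ∈ Finset.range M,
          (Measure.pi fun _ : V => μ).real (⋃ l ∈ F v m, E l) :=
        (measureReal_biUnion_finset_le _ _).trans
          (Finset.sum_le_sum fun v _ => measureReal_biUnion_finset_le _ _)
    _ ≤ ∑ v ∈ Finset.univ.filter (fun v => u v = 0), ∑ m ∈ Finset.range M, (1 / 2 ^ n : ℝ) :=
        Finset.sum_le_sum fun v hv => Finset.sum_le_sum fun m _ => hbound v hv m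
    _ ≤ ∑ v : V, ∑ m ∈ Finset.range M, (1 / 2 ^ n : ℝ) :=
        Finset.sum_le_sum_of_subset_of_nonneg (Finset.filter_subset _ _)
          fun _ _ _ => by positivity
    _ = _ := by
        simp only [Finset.sum_const, Finset.card_range, Finset.card_univ, nsmul_eq_mul]
        ring

end Percolation

end AbGame

namespace AbGame

/-! ### Refining contours round by round -/

section Contour

variable {α : Type*} {u s : α → ℕ} {κ : ℕ}

/-- Each point `v` is replaced by the pair `l v`, `r v`, traversed in this order; the last `r` gains
the extra unit of height. -/
theorem reflTransGen_contourStep_refine {P P' : α → Prop}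
    (h : ∀ v, P v → ∃ a b, P' a ∧ P' b ∧ u a = u v ∧ u b = u v + 1 ∧
      (s v ≤ s a ∧ s a ≤ s v + 1) ∧ (s v ≤ s b ∧ s b ≤ s v + 1) ∧ |(s b : ℤ) - s a| ≤ κ)
    {v w : α} (hv : P v)
    (hvw : Relation.ReflTransGen (fun a b => P a ∧ P b ∧ ContourStep u s κ a b) v w) :
    ∃ a b, P' a ∧ u a = u v ∧ u b = u w + 1 ∧
      Relation.ReflTransGen (fun a b => P' a ∧ P' b ∧ ContourStep u s κ a b) a b := by
  have h' : ∀ v, ∃ a b, P v → P' a ∧ P' b ∧ u a = u v ∧ u b = u v + 1 ∧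
      (s v ≤ s a ∧ s a ≤ s v + 1) ∧ (s v ≤ s b ∧ s b ≤ s v + 1) ∧
      |(s b : ℤ) - s a| ≤ κ := by
    intro v
    by_cases hPv : P v
    · obtain ⟨a, b, hab⟩ := h v hPv
      exact ⟨a, b, fun _ => hab⟩
    · exact ⟨v, v, fun hP => absurd hP hPv⟩
  choose l r hlr using h'
  have hstep : ∀ v, P v → ContourStep u s κ (l v) (r v) := by
    intro v hv
    obtain ⟨-, -, h1, h2, -, -, h3⟩ := hlr v hv
    unfold ContourStep
    omega
  -- The transversal distance may grow by one, but `r a` is one higher than `a`, so the step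
  -- constraint is preserved.
  have hcross : ∀ a b, P a → P b → ContourStep u s κ a b → ContourStep u s κ (r a) (l b) := by
    intro a b ha hb hab
    obtain ⟨-, -, -, h2, -, h3, -⟩ := hlr a ha
    obtain ⟨-, -, h1, -, h4, -, -⟩ := hlr b hb
    unfold ContourStep at *
    have := abs_le.1 (le_refl |(s b : ℤ) - s a|)
    have : |(s (l b) : ℤ) - s (r a)| ≤ |(s b : ℤ) - s a| + 1 := by
      rw [abs_le]; omega
    omega
  have hw : P w ∧ Relation.ReflTransGen (fun a b => P' a ∧ P' b ∧ ContourStep u s κ a b)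
      (l v) (r w) := by
    induction hvw with
    | refl => exact ⟨hv, .single ⟨(hlr v hv).1, (hlr v hv).2.1, hstep v hv⟩⟩
    | @tail b c _ hbc ih =>
      obtain ⟨hb, hc, hbc⟩ := hbc
      exact ⟨hc, (ih.2.tail ⟨(hlr b hb).2.1, (hlr c hc).1, hcross b c hb hc hbc⟩).tail
        ⟨(hlr c hc).1, (hlr c hc).2.1, hstep c hc⟩⟩
  exact ⟨l v, r w, (hlr v hv).1, (hlr v hv).2.2.1, (hlr w hw.1).2.2.2.1, hw.2⟩

theorem exists_reflTransGen_contourStep {P : ℕ → α → Prop}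
    (h : ∀ k v, P (k + 1) v → ∃ a b, P k a ∧ P k b ∧ u a = u v ∧ u b = u v + 1 ∧
      (s v ≤ s a ∧ s a ≤ s v + 1) ∧ (s v ≤ s b ∧ s b ≤ s v + 1) ∧ |(s b : ℤ) - s a| ≤ κ)
    {n : ℕ} {v w : α} (hv : P n v)
    (hvw : Relation.ReflTransGen (fun a b => P n a ∧ P n b ∧ ContourStep u s κ a b) v w) :
    ∃ a b, P 0 a ∧ u a = u v ∧ u b = u w + n ∧
      Relation.ReflTransGen (fun a b => P 0 a ∧ P 0 b ∧ ContourStep u s κ a b) a b := by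
  induction n generalizing v w with
  | zero => exact ⟨v, w, hv, rfl, rfl, hvw⟩
  | succ n ih =>
    obtain ⟨a, b, ha, hav, hbw, hab⟩ := reflTransGen_contourStep_refine (h n) hv hvw
    obtain ⟨a', b', ha', haa, hbb, hab'⟩ := ih ha hab
    exact ⟨a', b', ha', by omega, by omega, hab'⟩

end Contour

/-! ### Backward induction and contours in the game -/

/-- The outcome that corresponds to a final state. -/
def toOutcome (n : ℕ) (v : State) : Outcome n :=
  if h : v.1 ∈ antidiagonal n ∧ v.2 ∈ antidiagonal n then (⟨v.1, h.1⟩, ⟨v.2, h.2⟩)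
  else outcome n (fun _ => false) fun _ => false

theorem toOutcome_of_mem {n : ℕ} {v : State} (h : v.1 ∈ antidiagonal n ∧ v.2 ∈ antidiagonal n) :
    toOutcome n v = (⟨v.1, h.1⟩, ⟨v.2, h.2⟩) :=
  dif_pos h

theorem toOutcome_play (n : ℕ) (σ₁ σ₂ : Strategy) :
    toOutcome n (play σ₁ σ₂ n) = outcome n σ₁ σ₂ :=
  toOutcome_of_mem (play_mem σ₁ σ₂ n)

/-- Bob can force a win from the given state when `k` rounds remain, by backward induction. -/
def BobForces {n : ℕ} (x : Outcome n → Bool) : ℕ → State → Prop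
  | 0, v => x (toOutcome n v) = true
  | k + 1, v => ∀ a, ∃ b, BobForces x k (addMove v.1 a, addMove v.2 b)

theorem BobForces.bobWins {n : ℕ} {x : Outcome n → Bool} (h : BobForces x n ((0, 0), (0, 0))) :
    BobWins n x := by
  -- A strategy sees only the state, so the number of remaining rounds is read off from the counts
  -- of the player about to move.
  have hex : ∀ w : State, ∃ b,
      (∃ b, BobForces x (n - (w.2.1 + w.2.2 + 1)) (w.1, addMove w.2 b)) →
        BobForces x (n - (w.2.1 + w.2.2 + 1)) (w.1, addMove w.2 b) := by
    intro w
    by_cases hw : ∃ b, BobForces x (n - (w.2.1 + w.2.2 + 1)) (w.1, addMove w.2 b)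
    · exact hw.imp fun _ hb _ => hb
    · exact ⟨false, fun h => absurd h hw⟩
  choose σ₂ hσ₂ using hex
  refine ⟨σ₂, fun σ₁ => ?_⟩
  have key : ∀ j ≤ n, BobForces x (n - j) (play σ₁ σ₂ j) := by
    intro j
    induction j with
    | zero => exact fun _ => h
    | succ j ih =>
      intro hj
      have hp := ih (by omega)
      have hm := mem_antidiagonal.1 (play_mem σ₁ σ₂ j).2
      rw [show n - j = n - (j + 1) + 1 by omega] at hp
      have := hσ₂ (addMove (play σ₁ σ₂ j).1 (σ₁ (play σ₁ σ₂ j)), (play σ₁ σ₂ j).2)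
      simp only [hm] at this
      exact this (hp _)
  have := key n le_rfl
  rwa [Nat.sub_self, BobForces, toOutcome_play] at this

theorem BobWins.bobForces {n : ℕ} {x : Outcome n → Bool} (h : BobWins n x) :
    BobForces x n ((0, 0), (0, 0)) := by
  by_contra hx
  have hex : ∀ v : State, ∃ a,
      (∃ a, ∀ b, ¬ BobForces x (n - (v.1.1 + v.1.2 + 1)) (addMove v.1 a, addMove v.2 b)) →
        ∀ b, ¬ BobForces x (n - (v.1.1 + v.1.2 + 1)) (addMove v.1 a, addMove v.2 b) := by
    intro v
    by_cases hv : ∃ a, ∀ b,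
        ¬ BobForces x (n - (v.1.1 + v.1.2 + 1)) (addMove v.1 a, addMove v.2 b)
    · exact hv.imp fun _ ha _ => ha
    · exact ⟨false, fun h => absurd h hv⟩
  choose σ₁ hσ₁ using hex
  obtain ⟨σ₂, hσ₂⟩ := h
  have key : ∀ j ≤ n, ¬ BobForces x (n - j) (play σ₁ σ₂ j) := by
    intro j
    induction j with
    | zero => exact fun _ => hx
    | succ j ih =>
      intro hj
      have hp := ih (by omega)
      have hm := mem_antidiagonal.1 (play_mem σ₁ σ₂ j).1
      rw [show n - j = n - (j + 1) + 1 by omega] at hp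
      simp only [BobForces, not_forall, not_exists] at hp
      have := hσ₁ (play σ₁ σ₂ j)
      simp only [hm] at this
      exact this hp _
  have := key n le_rfl
  rw [Nat.sub_self, BobForces, toOutcome_play] at this
  exact this (hσ₂ σ₁)

theorem addMove_sum (c : Counts) (m : Bool) :
    (addMove c m).1 + (addMove c m).2 = c.1 + c.2 + 1 := by
  cases m <;> simp only [addMove] <;> omega

theorem addMove_snd_bounds (c : Counts) (m : Bool) :
    c.2 ≤ (addMove c m).2 ∧ (addMove c m).2 ≤ c.2 + 1 := by
  cases m <;> simp [addMove]

/-- Both players still have `k` moves to play. -/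
def MovesLeft (n k : ℕ) (v : State) : Prop :=
  v.1.1 + v.1.2 + k = n ∧ v.2.1 + v.2.2 + k = n

theorem MovesLeft.addMove {n k : ℕ} {v : State} (h : MovesLeft n (k + 1) v) (a b : Bool) :
    MovesLeft n k (addMove v.1 a, addMove v.2 b) := by
  have h1 := addMove_sum v.1 a
  have h2 := addMove_sum v.2 b
  unfold MovesLeft at *
  dsimp only
  omega

theorem MovesLeft.coe_toOutcome {n : ℕ} {v : State} (h : MovesLeft n 0 v) :
    ((toOutcome n v).1.val, (toOutcome n v).2.val) = v := by
  rw [toOutcome_of_mem (v := v) ⟨mem_antidiagonal.2 h.1, mem_antidiagonal.2 h.2⟩]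

theorem hasContour_of_levels {n κ : ℕ} {x : Outcome n → Bool} {c : Bool} {u s : State → ℕ}
    {P : ℕ → State → Prop} (hu : u ((0, 0), (0, 0)) = 0)
    (hML : ∀ v, P 0 v → MovesLeft n 0 v ∧ x (toOutcome n v) = c)
    (h : ∀ k v, P (k + 1) v → ∃ a b, P k a ∧ P k b ∧ u a = u v ∧ u b = u v + 1 ∧
      (s v ≤ s a ∧ s a ≤ s v + 1) ∧ (s v ≤ s b ∧ s b ≤ s v + 1) ∧ |(s b : ℤ) - s a| ≤ κ)
    (hP : P n ((0, 0), (0, 0))) :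
    HasContour (fun o : Outcome n => u (o.1.val, o.2.val)) (fun o => s (o.1.val, o.2.val))
      κ n c x := by
  obtain ⟨a, b, ha, hua, hub, hab⟩ := exists_reflTransGen_contourStep h hP .refl
  have hb : P 0 b := by
    rcases hab.cases_tail with rfl | ⟨_, _, h⟩
    · exact ha
    · exact h.2.1
  refine ⟨toOutcome n a, toOutcome n b, ?_, ?_, (hML a ha).2, ?_⟩
  · simp only [(hML a ha).1.coe_toOutcome]; omega
  · simp only [(hML b hb).1.coe_toOutcome]; omega
  · refine hab.lift _ fun a b hab => ⟨?_, (hML b hab.2.1).2⟩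
    have := hab.2.2
    simpa only [ContourStep, (hML a hab.1).1.coe_toOutcome, (hML b hab.2.1).1.coe_toOutcome]
      using this

/-- Here `κ = 1`, because Bob's reply may depend on Alice's move. -/
theorem BobForces.hasContour {n : ℕ} {x : Outcome n → Bool}
    (h : BobForces x n ((0, 0), (0, 0))) :
    HasContour (fun o : Outcome n => o.1.val.2) (fun o => o.2.val.2) 1 n true x := by
  refine hasContour_of_levels (u := fun v => v.1.2) (s := fun v => v.2.2)
    (P := fun k v => MovesLeft n k v ∧ BobForces x k v) rfl (fun v hv => hv) ?_
    ⟨by simp [MovesLeft], h⟩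
  rintro k v ⟨hv, hx⟩
  obtain ⟨b₀, h₀⟩ := hx false
  obtain ⟨b₁, h₁⟩ := hx true
  have hb₀ := addMove_snd_bounds v.2 b₀
  have hb₁ := addMove_snd_bounds v.2 b₁
  refine ⟨_, _, ⟨hv.addMove _ _, h₀⟩, ⟨hv.addMove _ _, h₁⟩, rfl, rfl, hb₀, hb₁, ?_⟩
  rw [abs_le]
  dsimp only
  omega

/-- Here `κ = 0`: Alice moves first, so a single move of hers must work against both replies. -/
theorem hasContour_of_not_bobForces {n : ℕ} {x : Outcome n → Bool}
    (h : ¬ BobForces x n ((0, 0), (0, 0))) :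
    HasContour (fun o : Outcome n => o.2.val.2) (fun o => o.1.val.2) 0 n false x := by
  refine hasContour_of_levels (u := fun v => v.2.2) (s := fun v => v.1.2)
    (P := fun k v => MovesLeft n k v ∧ ¬ BobForces x k v) rfl
    (fun v hv => ⟨hv.1, by simpa [BobForces] using hv.2⟩) ?_ ⟨by simp [MovesLeft], h⟩
  rintro k v ⟨hv, hx⟩
  simp only [BobForces, not_forall, not_exists] at hx
  obtain ⟨a, ha⟩ := hx
  have hb := addMove_snd_bounds v.1 a
  exact ⟨_, _, ⟨hv.addMove _ _, ha false⟩, ⟨hv.addMove _ _, ha true⟩, rfl, rfl, hb, hb, by simp⟩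

theorem outcome_ext {n : ℕ} {o o' : Outcome n} (h₁ : o.1.val.2 = o'.1.val.2)
    (h₂ : o.2.val.2 = o'.2.val.2) : o = o' := by
  obtain ⟨⟨⟨a, b⟩, hab⟩, ⟨⟨c, d⟩, hcd⟩⟩ := o
  obtain ⟨⟨⟨a', b'⟩, hab'⟩, ⟨⟨c', d'⟩, hcd'⟩⟩ := o'
  simp only [mem_antidiagonal] at hab hcd hab' hcd'
  dsimp only at h₁ h₂
  simp only [Prod.mk.injEq, Subtype.mk.injEq]
  omega

/-! ### Probability bounds and the limit -/

theorem card_outcome (n : ℕ) : Fintype.card (Outcome n) = (n + 1) ^ 2 := by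
  simp [Fintype.card_prod, Finset.Nat.card_antidiagonal, sq]

instance (n : ℕ) (p : I) : IsProbabilityMeasure (winnerLaw n p) := by
  unfold winnerLaw; infer_instance

theorem bobWinProb_le {n : ℕ} {p : I} (hp : (p : ℝ) < 1 / 64) :
    bobWinProb n p ≤ ((n + 1 : ℕ) : ℝ) ^ 4 / 2 ^ n := by
  have hμ : (bernoulliMeasure true false p).real {true} = p := by
    rw [bernoulliMeasure_real_apply_of_mem_of_notMem p (by simp) (by simp) (by simp)]
  have h := pi_real_hasContour_le (u := fun o : Outcome n => o.1.val.2)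
    (s := fun o => o.2.val.2) (bernoulliMeasure true false p) true
    -- With `κ = 1` only `20 p ≤ 1` is required.
    (fun _ _ => outcome_ext) 1 n (by rw [hμ]; push_cast; linarith)
  rw [card_outcome] at h
  calc bobWinProb n p ≤ _ :=
        measureReal_mono (fun x hx => (BobWins.bobForces hx).hasContour) (measure_ne_top _ _)
    _ ≤ _ := h
    _ = _ := by push_cast; ring

theorem one_sub_bobWinProb_le {n : ℕ} {p : I} (hp : (15 / 16 : ℝ) < p) :
    1 - bobWinProb n p ≤ ((n + 1 : ℕ) : ℝ) ^ 4 / 2 ^ n := by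
  have hμ : (bernoulliMeasure true false p).real {false} = 1 - p := by
    rw [bernoulliMeasure_real_apply_of_notMem_of_mem p (by simp) (by simp) (by simp)]
  have h := pi_real_hasContour_le (u := fun o : Outcome n => o.2.val.2)
    (s := fun o => o.1.val.2) (bernoulliMeasure true false p) false
    -- With `κ = 0` only `12 (1 - p) ≤ 1` is required.
    (fun _ _ h₁ h₂ => outcome_ext h₂ h₁) 0 n (by rw [hμ]; push_cast; linarith)
  rw [card_outcome] at h
  rw [bobWinProb, ← probReal_compl_eq_one_sub (Set.toFinite _).measurableSet]
  calc _ ≤ _ := measureReal_mono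
        (fun x (hx : ¬ BobWins n x) => hasContour_of_not_bobForces fun hb => hx hb.bobWins) (measure_ne_top _ _)
    _ ≤ _ := h
    _ = _ := by push_cast; ring

theorem tendsto_succ_pow_four_div_two_pow :
    Tendsto (fun n : ℕ => ((n + 1 : ℕ) : ℝ) ^ 4 / 2 ^ n) atTop (𝓝 0) := by
  have h := ((tendsto_pow_const_div_const_pow_of_one_lt 4 (r := (2 : ℝ)) (by norm_num)).comp
    (tendsto_add_atTop_nat 1)).const_mul 2
  rw [mul_zero] at h
  refine h.congr fun n => ?_
  simp only [Function.comp_apply, pow_succ (2 : ℝ) n]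
  field_simp

end AbGame

theorem proposition1p4 (p : I) :
    ((p : ℝ) < 1 / 64 → Tendsto (fun n : ℕ => AbGame.bobWinProb n p) atTop (𝓝 0)) ∧
      ((15 / 16 : ℝ) < (p : ℝ) → Tendsto (fun n : ℕ => AbGame.bobWinProb n p) atTop (𝓝 1)) := by
  have h0 := AbGame.tendsto_succ_pow_four_div_two_pow
  refine ⟨fun hp => squeeze_zero (fun _ => measureReal_nonneg)
    (fun _ => AbGame.bobWinProb_le hp) h0, fun hp => ?_⟩
  have h1 : Tendsto (fun n : ℕ => 1 - ((n + 1 : ℕ) : ℝ) ^ 4 / 2 ^ n) atTop (𝓝 1) := by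
    simpa using h0.const_sub 1
  refine tendsto_of_tendsto_of_tendsto_of_le_of_le h1 tendsto_const_nhds
    (fun n => sub_le_comm.1 (AbGame.one_sub_bobWinProb_le hp)) fun n => ?_
  exact measureReal_le_one
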